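/- Let $d \ge 0$ and $0 \le n \le d+1$ be integers, and let $\mathcal{H}^n$ denote the $n$-dimensional Hausdorff (outer) measure on $\mathbb{R}^{d+1}$. A set $E \subseteq \mathbb{R}^{d+1}$ is called $n$-rectifiable if there are sets $E_i \subseteq \mathbb{R}^n$ and Lipschitz maps $f_i : E_i \to \mathbb{R}^{d+1}$, $i = 1, 2, \dots$, such that $\mathcal{H}^n\bigl(E \setminus \bigcup_{i=1}^\infty f_i(E_i)\bigr) = 0$. A map $F : \mathbb{R}^n \to \mathbb{R}^{d+1}$ is called bi-Lipschitz if there is $L \ge 1$ such that $L^{-1}|x-y| \le |F(x)-F(y)| \le L|x-y|$ for all $x, y \in \mathbb{R}^n$. **Proposition 4.1.** A set $E \subseteq \mathbb{R}^{d+1}$ (in particular, any Borel set) is $n$-rectifiable if and only if there are bi-Lipschitz maps $F_i : \mathbb{R}^n \to \mathbb{R}^{d+1}$, $i = 1, 2, \dots$, such that $$\mathcal{H}^n\Bigl(E \setminus \bigcup_{i=1}^\infty F_i(\mathbb{R}^n)\Bigr) = 0.$$ The constants of the maps $f_i$ and $F_i$ may depend on $i$. -/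

import Mathlib

open MeasureTheory

/-- A map between metric spaces is bi-Lipschitz if it distorts distances by at most a
multiplicative constant from above and from below. -/
def IsBiLipschitz {X Y : Type*} [PseudoEMetricSpace X] [PseudoEMetricSpace Y] (f : X → Y) : Prop :=
  ∃ K K' : NNReal, LipschitzWith K f ∧ AntilipschitzWith K' f

/-- A set `E` in `ℝ^m` is `n`-rectifiable if, up to a set of `n`-dimensional Hausdorff measure
zero, it is covered by countably many Lipschitz images `f i '' S i` of subsets `S i ⊆ ℝ^n`.
Only the values of `f i` on `S i` matter, and the Lipschitz constant may depend on `i`. -/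
def IsNRectifiable {m : ℕ} (n : ℕ) (E : Set (EuclideanSpace ℝ (Fin m))) : Prop :=
  ∃ (S : ℕ → Set (EuclideanSpace ℝ (Fin n)))
    (f : ℕ → EuclideanSpace ℝ (Fin n) → EuclideanSpace ℝ (Fin m)),
    (∀ i, ∃ K : NNReal, LipschitzOnWith K (f i) (S i)) ∧
      Measure.hausdorffMeasure (n : ℝ) (E \ ⋃ i, f i '' S i) = 0

/-! Only the forward direction has content. Extend each `f i` to a Lipschitz map on all of `ℝ^n` and
split the domain in three. Nondifferentiability points are null by Rademacher, hence so is their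
image. Critical points (noninjective derivative) have null image by a Sard-type estimate. Regular
points are covered by countably many sets on which the map is so close to an injective linear map
that it agrees there with a global bi-Lipschitz map. -/

open Module Set
open scoped NNReal ENNReal Topology

section HausdorffMeasure

variable {X Y Z : Type*} [MetricSpace X] [MeasurableSpace X] [BorelSpace X]
  [MetricSpace Y] [MeasurableSpace Y] [BorelSpace Y]

/-- If `f` is Lipschitz relative to `T` on `s`, then the image under `f` has Hausdorff measure
controlled by that of the image under `T`. -/
theorem hausdorffMeasure_image_le_of_dist_le {f : Z → Y} {T : Z → X} {s : Set Z} {K : ℝ≥0}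
    (h : ∀ x ∈ s, ∀ y ∈ s, dist (f x) (f y) ≤ K * dist (T x) (T y)) {d : ℝ} (hd : 0 ≤ d) :
    Measure.hausdorffMeasure d (f '' s) ≤ (K : ℝ≥0∞) ^ d * Measure.hausdorffMeasure d (T '' s) := by
  rcases s.eq_empty_or_nonempty with rfl | ⟨x₀, -⟩
  · simp
  have : Nonempty Z := ⟨x₀⟩
  set g : X → Z := Function.invFunOn T s
  have hg : ∀ x ∈ s, g (T x) ∈ s ∧ T (g (T x)) = T x := fun x hx =>
    ⟨Function.invFunOn_mem ⟨x, hx, rfl⟩, Function.invFunOn_eq ⟨x, hx, rfl⟩⟩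
  -- On `s`, `f` factors through `T`: the choice of preimage `g` is harmless, since `h` forces `f`
  -- to be constant on the fibres of `T`.
  have hLip : LipschitzOnWith K (f ∘ g) (T '' s) := by
    refine LipschitzOnWith.of_dist_le_mul ?_
    rintro _ ⟨x, hx, rfl⟩ _ ⟨y, hy, rfl⟩
    have := h _ (hg x hx).1 _ (hg y hy).1
    rwa [(hg x hx).2, (hg y hy).2] at this
  have hsub : f '' s ⊆ (f ∘ g) '' (T '' s) := by
    rintro _ ⟨x, hx, rfl⟩
    refine ⟨T x, ⟨x, hx, rfl⟩, ?_⟩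
    have := h _ (hg x hx).1 x hx
    rw [(hg x hx).2, dist_self, mul_zero] at this
    exact dist_le_zero.1 this
  exact (measure_mono hsub).trans (hLip.hausdorffMeasure_image_le hd)

end HausdorffMeasure

section CriticalSet

variable {E F : Type*} [NormedAddCommGroup E] [InnerProductSpace ℝ E] [FiniteDimensional ℝ E]
  [MeasurableSpace E] [BorelSpace E]
  [NormedAddCommGroup F] [NormedSpace ℝ F] [MeasurableSpace F] [BorelSpace F]

/-- A map that is `ε`-close to a noninjective linear map on `s` shrinks the Hausdorff measure of `s`
by a factor proportional to `ε`: factor it through the contraction by `ε` of a direction in the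
kernel. -/
theorem ApproximatesLinearOn.hausdorffMeasure_image_le_of_ker {f : E → F} {L : E →L[ℝ] F}
    {s : Set E} {ε K : ℝ≥0} (hf : ApproximatesLinearOn f L s ε) (hε : 0 < ε) (hε1 : ε ≤ 1)
    (hL : ‖L‖ ≤ K) (hinj : ¬ Function.Injective L) :
    Measure.hausdorffMeasure (finrank ℝ E) (f '' s) ≤
      ((K + 1 : ℝ≥0) : ℝ≥0∞) ^ (finrank ℝ E : ℝ) *
        (ε * Measure.hausdorffMeasure (finrank ℝ E) s) := by
  obtain ⟨v, hv, hLv⟩ : ∃ v : E, ‖v‖ = 1 ∧ L v = 0 := by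
    rw [injective_iff_map_eq_zero] at hinj
    push Not at hinj
    obtain ⟨w, hw, hw0⟩ := hinj
    exact ⟨(‖w‖⁻¹ : ℝ) • w, norm_smul_inv_norm hw0, by simp [hw]⟩
  -- `T` scales the kernel direction `v` by `ε` and fixes its orthogonal complement, so `det T = ε`
  -- and `L ∘ T = L`.
  set T : E →ₗ[ℝ] E :=
    LinearMap.transvection (innerₛₗ ℝ v) (((ε : ℝ) - 1) • v) with hT
  have hTz : ∀ z, T z = z + inner ℝ v z • (((ε : ℝ) - 1) • v) := fun z => rfl
  have hdet : LinearMap.det T = ε := by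
    rw [hT, LinearMap.transvection.det]
    simp [hv]
  have hLT : ∀ z, L (T z) = L z := fun z => by simp [hTz, hLv]
  have hεpos : (0 : ℝ) < ε := hε
  have hεle : (ε : ℝ) ≤ 1 := hε1
  have hlow : ∀ z, (ε : ℝ) * ‖z‖ ≤ ‖T z‖ := by
    intro z
    have h1 : inner ℝ v (T z) = ε * inner ℝ v z := by
      simp [hTz, inner_add_right, inner_smul_right, hv]
      ring
    have h2 : (ε : ℝ) • z = (ε : ℝ) • T z + ((1 - (ε : ℝ)) * inner ℝ v (T z)) • v := by
      rw [h1, hTz]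
      module
    have h3 : |inner ℝ v (T z)| ≤ ‖T z‖ := by
      simpa [hv] using abs_real_inner_le_norm v (T z)
    calc (ε : ℝ) * ‖z‖ = ‖(ε : ℝ) • z‖ := by simp [norm_smul]
      _ ≤ ‖(ε : ℝ) • T z‖ + ‖((1 - (ε : ℝ)) * inner ℝ v (T z)) • v‖ := by
          rw [h2]; exact norm_add_le _ _
      _ = ε * ‖T z‖ + (1 - ε) * |inner ℝ v (T z)| := by
          simp [norm_smul, hv, abs_of_nonneg (sub_nonneg.2 hεle)]
      _ ≤ ε * ‖T z‖ + (1 - ε) * ‖T z‖ := by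
          gcongr
      _ = ‖T z‖ := by ring
  -- The approximation error `ε * ‖x - y‖` is absorbed by `hlow`, giving the `1` in `K + 1`; the
  -- linear part gives `K`.
  have hdist : ∀ x ∈ s, ∀ y ∈ s, dist (f x) (f y) ≤ (K + 1 : ℝ≥0) * dist (T x) (T y) := by
    intro x hx y hy
    rw [dist_eq_norm, dist_eq_norm, ← map_sub]
    calc ‖f x - f y‖ = ‖(f x - f y - L (x - y)) + L (T (x - y))‖ := by rw [hLT]; congr 1; abel
      _ ≤ ‖f x - f y - L (x - y)‖ + ‖L (T (x - y))‖ := norm_add_le _ _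
      _ ≤ ‖T (x - y)‖ + K * ‖T (x - y)‖ :=
          add_le_add ((hf x hx y hy).trans (hlow _)) (L.le_of_opNorm_le hL _)
      _ = (K + 1 : ℝ≥0) * ‖T (x - y)‖ := by push_cast; ring
  have key := hausdorffMeasure_image_le_of_dist_le hdist (d := finrank ℝ E) (Nat.cast_nonneg _)
  rwa [Measure.addHaar_image_linearMap, hdet, abs_of_pos hεpos, ENNReal.ofReal_coe_nnreal] at key

/-- Sard's theorem for Lipschitz maps: the set of critical values of a Lipschitz map on an
`n`-dimensional space is `μH[n]`-null. -/
theorem LipschitzWith.hausdorffMeasure_image_critical_eq_zero [SecondCountableTopology F]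
    {f : E → F} {K : ℝ≥0} (hf : LipschitzWith K f) :
    Measure.hausdorffMeasure (finrank ℝ E)
      (f '' {x | DifferentiableAt ℝ f x ∧ ¬ Function.Injective (fderiv ℝ f x)}) = 0 := by
  set C := {x | DifferentiableAt ℝ f x ∧ ¬ Function.Injective (fderiv ℝ f x)}
  -- Localizing to balls makes the measure finite, so that the factor `ε` can be sent to `0`.
  have hball : ∀ R : ℕ,
      Measure.hausdorffMeasure (finrank ℝ E) (f '' (C ∩ Metric.ball 0 R)) = 0 := by
    intro R
    set s := C ∩ Metric.ball (0 : E) R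
    set M := ((K + 1 : ℝ≥0) : ℝ≥0∞) ^ (finrank ℝ E : ℝ) *
      Measure.hausdorffMeasure (finrank ℝ E) (Metric.ball (0 : E) R)
    have hM : M ≠ ∞ :=
      ENNReal.mul_ne_top (ENNReal.rpow_ne_top_of_nonneg (Nat.cast_nonneg _) ENNReal.coe_ne_top)
        measure_ball_lt_top.ne
    have hle : ∀ ε : ℝ≥0, 0 < ε → ε ≤ 1 →
        Measure.hausdorffMeasure (finrank ℝ E) (f '' s) ≤ ε * M := by
      intro ε hε hε1
      rcases s.eq_empty_or_nonempty with hs | hs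
      · simp [hs]
      obtain ⟨t, A, tdisj, tmeas, st, happ, hA⟩ :=
        exists_partition_approximatesLinearOn_of_hasFDerivWithinAt f s (fderiv ℝ f)
          (fun x hx => hx.1.1.hasFDerivAt.hasFDerivWithinAt) (fun _ => ε) (fun _ => hε.ne')
      -- Enlarging `s` to the ball gives measurable disjoint pieces whose measures add up, with no
      -- need for measurability of `C`.
      have hpiece : ∀ k, Measure.hausdorffMeasure (finrank ℝ E) (f '' (s ∩ t k)) ≤
          ((K + 1 : ℝ≥0) : ℝ≥0∞) ^ (finrank ℝ E : ℝ) *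
            (ε * Measure.hausdorffMeasure (finrank ℝ E) (Metric.ball (0 : E) R ∩ t k)) := by
        intro k
        obtain ⟨y, hy, hAy⟩ := hA hs k
        refine ((happ k).hausdorffMeasure_image_le_of_ker hε hε1 (K := K) ?_ ?_).trans ?_
        · rw [hAy]; exact norm_fderiv_le_of_lipschitz ℝ hf
        · rw [hAy]; exact hy.1.2
        · gcongr
          exact inter_subset_right
      calc Measure.hausdorffMeasure (finrank ℝ E) (f '' s)
          ≤ Measure.hausdorffMeasure (finrank ℝ E) (⋃ k, f '' (s ∩ t k)) := by
            rw [← image_iUnion, ← inter_iUnion, inter_eq_left.2 st]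
        _ ≤ ∑' k, Measure.hausdorffMeasure (finrank ℝ E) (f '' (s ∩ t k)) :=
            measure_iUnion_le _
        _ ≤ ∑' k, ((K + 1 : ℝ≥0) : ℝ≥0∞) ^ (finrank ℝ E : ℝ) *
            (ε * Measure.hausdorffMeasure (finrank ℝ E) (Metric.ball (0 : E) R ∩ t k)) :=
            ENNReal.tsum_le_tsum hpiece
        _ = ((K + 1 : ℝ≥0) : ℝ≥0∞) ^ (finrank ℝ E : ℝ) * (ε *
            Measure.hausdorffMeasure (finrank ℝ E) (⋃ k, Metric.ball (0 : E) R ∩ t k)) := by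
            rw [ENNReal.tsum_mul_left, ENNReal.tsum_mul_left, measure_iUnion]
            · exact fun i j hij => (tdisj hij).mono inter_subset_right inter_subset_right
            · exact fun k => measurableSet_ball.inter (tmeas k)
        _ ≤ ((K + 1 : ℝ≥0) : ℝ≥0∞) ^ (finrank ℝ E : ℝ) * (ε *
            Measure.hausdorffMeasure (finrank ℝ E) (Metric.ball (0 : E) R)) := by
            gcongr
            exact iUnion_subset fun k => inter_subset_left
        _ = ε * M := by simp only [M]; ring
    refine nonpos_iff_eq_zero.1 (ge_of_tendsto (x := 𝓝[>] (0 : ℝ≥0))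
      (f := fun ε : ℝ≥0 => (ε : ℝ≥0∞) * M) ?_ ?_)
    · have h : Filter.Tendsto (fun ε : ℝ≥0 => (ε : ℝ≥0∞)) (𝓝[>] 0) (𝓝 ((0 : ℝ≥0) : ℝ≥0∞)) :=
        ENNReal.tendsto_coe.2 (Filter.tendsto_id.mono_left nhdsWithin_le_nhds)
      simpa using ENNReal.Tendsto.mul_const h (Or.inr hM)
    · filter_upwards [Ioc_mem_nhdsGT (zero_lt_one (α := ℝ≥0))] with ε hε
      exact hle ε hε.1 hε.2
  refine measure_mono_null ?_ (measure_iUnion_null hball)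
  rw [← image_iUnion, ← inter_iUnion, Metric.iUnion_ball_nat, inter_univ]

end CriticalSet

section BiLipschitz

variable {E F : Type*} [NormedAddCommGroup E] [NormedSpace ℝ E]
  [NormedAddCommGroup F] [NormedSpace ℝ F]

/-- An injective linear map on a finite-dimensional space is bi-Lipschitz. -/
theorem ContinuousLinearMap.isBiLipschitz_of_injective [FiniteDimensional ℝ E] {L : E →L[ℝ] F}
    (hL : Function.Injective L) : IsBiLipschitz L := by
  obtain ⟨K, -, hK⟩ := L.toLinearMap.exists_antilipschitzWith (LinearMap.ker_eq_bot.2 hL)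
  exact ⟨_, _, L.lipschitz, hK⟩

/-- A map that is close enough to an antilipschitz linear map on `s` agrees on `s` with a globally
defined bi-Lipschitz map. -/
theorem ApproximatesLinearOn.exists_isBiLipschitz_eqOn [FiniteDimensional ℝ F] {f : E → F}
    {L : E →L[ℝ] F} {s : Set E} {c K : ℝ≥0} (hf : ApproximatesLinearOn f L s c)
    (hL : AntilipschitzWith K L) (hc : lipschitzExtensionConstant F * c < K⁻¹) :
    ∃ g : E → F, IsBiLipschitz g ∧ EqOn f g s := by
  -- Extend only the small error `f - L`: a perturbation of `L` with Lipschitz constant below `K⁻¹`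
  -- stays antilipschitz.
  obtain ⟨u, hu, huf⟩ := hf.lipschitzOnWith.extend_finite_dimension
  refine ⟨fun x => L x + u x, ⟨_, _, L.lipschitz.add hu, hL.add_lipschitzWith hu hc⟩, ?_⟩
  intro x hx
  simp [← huf hx]

end BiLipschitz

section Covering

variable {E F : Type*} [NormedAddCommGroup E] [InnerProductSpace ℝ E] [FiniteDimensional ℝ E]
  [NormedAddCommGroup F] [NormedSpace ℝ F] [FiniteDimensional ℝ F]

/-- The regular points of a map are covered by countably many sets on each of which it agrees with
a globally defined bi-Lipschitz map. -/
theorem exists_isBiLipschitz_image_regular_subset (f : E → F) (hEF : finrank ℝ E ≤ finrank ℝ F) :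
    ∃ g : ℕ → E → F, (∀ i, IsBiLipschitz (g i)) ∧
      f '' {x | DifferentiableAt ℝ f x ∧ Function.Injective (fderiv ℝ f x)} ⊆
        ⋃ i, range (g i) := by
  set s := {x | DifferentiableAt ℝ f x ∧ Function.Injective (fderiv ℝ f x)}
  rcases s.eq_empty_or_nonempty with hs | hs
  -- With no regular points, some bi-Lipschitz map must still be supplied; the dimension bound
  -- provides a linear one.
  · obtain ⟨L, hL⟩ := finrank_le_iff_exists_linearMap.1 hEF
    exact ⟨fun _ => L.toContinuousLinearMap,
      fun _ => ContinuousLinearMap.isBiLipschitz_of_injective hL, by simp [hs]⟩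
  have hr : ∀ L : E →L[ℝ] F, ∃ r : ℝ≥0, r ≠ 0 ∧ (Function.Injective L →
      ∃ K, AntilipschitzWith K L ∧ lipschitzExtensionConstant F * r < K⁻¹) := by
    intro L
    by_cases hL : Function.Injective L
    · obtain ⟨K, hK, hLK⟩ := L.toLinearMap.exists_antilipschitzWith (LinearMap.ker_eq_bot.2 hL)
      have hC := lipschitzExtensionConstant_pos F
      have hpos : 0 < K⁻¹ / lipschitzExtensionConstant F := by positivity
      obtain ⟨r, hr0, hr⟩ := exists_between hpos
      exact ⟨r, hr0.ne', fun _ => ⟨K, hLK, by rwa [lt_div_iff₀' hC] at hr⟩⟩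
    -- A dummy value: every `A k` used below is the derivative at a regular point.
    · exact ⟨1, one_ne_zero, fun h => absurd h hL⟩
  choose r hr0 hr using hr
  obtain ⟨t, A, -, st, happ, hA⟩ :=
    exists_closed_cover_approximatesLinearOn_of_hasFDerivWithinAt f s (fderiv ℝ f)
      (fun x hx => hx.1.hasFDerivAt.hasFDerivWithinAt) r hr0
  have hext : ∀ k, ∃ g : E → F, IsBiLipschitz g ∧ EqOn f g (s ∩ t k) := by
    intro k
    obtain ⟨y, hy, hAy⟩ := hA hs k
    obtain ⟨K, hK, hrK⟩ := hr (A k) (hAy ▸ hy.2)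
    exact (happ k).exists_isBiLipschitz_eqOn hK hrK
  choose g hg hfg using hext
  refine ⟨g, hg, ?_⟩
  rintro _ ⟨x, hx, rfl⟩
  obtain ⟨k, hk⟩ := mem_iUnion.1 (st hx)
  exact mem_iUnion.2 ⟨k, x, (hfg k ⟨hx, hk⟩).symm⟩

/-- A Lipschitz image of a subset of an `n`-dimensional space is covered, up to a `μH[n]`-null set,
by countably many bi-Lipschitz images of the whole space. -/
theorem LipschitzOnWith.exists_isBiLipschitz_cover [MeasurableSpace E] [BorelSpace E]
    [MeasurableSpace F] [BorelSpace F] {f : E → F} {S : Set E} {K : ℝ≥0}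
    (hf : LipschitzOnWith K f S) (hEF : finrank ℝ E ≤ finrank ℝ F) :
    ∃ g : ℕ → E → F, (∀ i, IsBiLipschitz (g i)) ∧
      Measure.hausdorffMeasure (finrank ℝ E) (f '' S \ ⋃ i, range (g i)) = 0 := by
  obtain ⟨f', hf', hff'⟩ := hf.extend_finite_dimension
  obtain ⟨g, hg, hcover⟩ := exists_isBiLipschitz_image_regular_subset f' hEF
  refine ⟨g, hg, ?_⟩
  have hnd : Measure.hausdorffMeasure (finrank ℝ E) (f' '' {x | ¬ DifferentiableAt ℝ f' x}) = 0 := by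
    refine nonpos_iff_eq_zero.1 ((hf'.hausdorffMeasure_image_le (Nat.cast_nonneg _) _).trans ?_)
    -- Rademacher's theorem applies because top-dimensional Hausdorff measure is a Haar measure.
    rw [ae_iff.1 (hf'.ae_differentiableAt (μ := Measure.hausdorffMeasure (finrank ℝ E))), mul_zero]
  refine measure_mono_null ?_ (measure_union_null hnd hf'.hausdorffMeasure_image_critical_eq_zero)
  rintro _ ⟨⟨x, hx, rfl⟩, hnot⟩
  rw [hff' hx] at hnot ⊢
  by_cases hd : DifferentiableAt ℝ f' x
  · refine Or.inr ⟨x, ⟨hd, fun hinj => hnot (hcover ⟨x, ⟨hd, hinj⟩, rfl⟩)⟩, rfl⟩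
  · exact Or.inl ⟨x, hd, rfl⟩

end Covering

theorem proposition4p1 (d n : ℕ) (hn : n ≤ d + 1) (E : Set (EuclideanSpace ℝ (Fin (d + 1)))) :
    IsNRectifiable n E ↔
      ∃ F : ℕ → EuclideanSpace ℝ (Fin n) → EuclideanSpace ℝ (Fin (d + 1)),
        (∀ i, IsBiLipschitz (F i)) ∧
          Measure.hausdorffMeasure (n : ℝ) (E \ ⋃ i, Set.range (F i)) = 0 := by
  constructor
  · rintro ⟨S, f, hf, hE⟩
    have hcover : ∀ i, ∃ g : ℕ → EuclideanSpace ℝ (Fin n) → EuclideanSpace ℝ (Fin (d + 1)),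
        (∀ j, IsBiLipschitz (g j)) ∧
          Measure.hausdorffMeasure (n : ℝ) (f i '' S i \ ⋃ j, range (g j)) = 0 := by
      intro i
      obtain ⟨K, hK⟩ := hf i
      simpa using hK.exists_isBiLipschitz_cover (by simpa using hn)
    choose g hg hnull using hcover
    -- The double sequence `g i j` is listed as one sequence by the pairing function.
    refine ⟨fun k => g k.unpair.1 k.unpair.2, fun k => hg _ _, ?_⟩
    refine measure_mono_null ?_ (measure_union_null hE (measure_iUnion_null hnull))
    rintro x ⟨hxE, hx⟩
    by_cases hxf : x ∈ ⋃ i, f i '' S i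
    · obtain ⟨i, hi⟩ := mem_iUnion.1 hxf
      refine Or.inr (mem_iUnion.2 ⟨i, hi, fun hj => hx ?_⟩)
      obtain ⟨j, hj⟩ := mem_iUnion.1 hj
      exact mem_iUnion.2 ⟨Nat.pair i j, by simpa using hj⟩
    · exact Or.inl ⟨hxE, hxf⟩
  · rintro ⟨F, hF, hE⟩
    refine ⟨fun _ => univ, F, fun i => ?_, by simpa only [image_univ] using hE⟩
    obtain ⟨K, -, hK, -⟩ := hF i
    exact ⟨K, hK.lipschitzOnWith⟩
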